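/- **Setting.** A \emph{Wilson loop diagram} $W=(\mathcal P,[n])$ consists of a cyclically ordered vertex set $[n]$ and a finite set $\mathcal P$ of propagators, a propagator being an unordered pair $p=(i,j)$ with $i,j\in[n]$ (joining the edges $\{i,i+1\}$ and $\{j,j+1\}$ of the $n$-gon, indices modulo $n$). Put $V_p=\{i,i+1,j,j+1\}$ and, for $P\subseteq\mathcal P$, $V_P=\bigcup_{p\in P}V_p$ (the dependency set of $P$). All diagrams are assumed well defined: $|V_P|>|P|+2$ for every non-empty $P\subseteq\mathcal P$. For $U\subseteq[n]$ let $\mathrm{Prop}(U)$ be the set of $p\in\mathcal P$ with $V_p\cap U\ne\emptyset$. The matroid $M(W)$ has ground set $[n]$ and bases $$\mathfrak B=\{B\subseteq[n] : |B|=|\mathcal P|,\ \text{there is no } U\subseteq B \text{ with } |U|>|\mathrm{Prop}(U)|\}.$$ For $P\subseteq\mathcal P$ write $P^c=\mathcal P\setminus P$, and let $F(P)$ be the set of vertices $v\in[n]$ such that every $p\in\mathcal P$ with $v\in V_p$ lies in $P$. A matroid is \emph{connected} if its ground set has no partition into two non-empty parts such that the union of any independent subset of one part and any independent subset of the other is independent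 (so the empty matroid is connected); $W$ is connected if $M(W)$ is. A \emph{cyclic flat} is a flat that is a union of circuits. A \emph{flacet} of a matroid $M$ on $E$ is a set $F\subseteq E$ such that the restriction $M|F$ and the contraction $M/F$ are both connected. **Theorem.** Let $W=(\mathcal P,[n])$ be a connected Wilson loop diagram with $\mathcal P\neq\emptyset$, and let $F\subseteq[n]$. Then $F$ is a flacet of $M(W)$ with $|F|\ge 2$ and $|[n]\setminus F|\neq 1$ if and only if $F=F(P)$ for some $P\subseteq\mathcal P$ satisfying the following three conditions. 1. $F(P)$ is a cyclic flat of $M(W)$ of maximal rank, i.e. $\mathrm{rk}\,F(P)=|P|<|F(P)|$. 2. There is no partition $P^c=Q_1\amalg Q_2$ into non-empty sets such that $V_{Q_1}$ and $V_{Q_2}$ are disjoint and $V_{Q_1}\cup V_{Q_2}=V_{P^c}$. 3. There is no partition $P=P_1\amalg P_2$ into non-empty sets such that $F(P_1)$ and $F(P_2)$ are disjoint and $F(P_1)\cup F(P_2)=F(P)$. -/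

import Mathlib

namespace WilsonLoops

/-- A propagator joins two edges of the boundary `n`-gon, whose vertices form the cyclic set
`Fin n` and whose edge number `i` joins the vertices `i` and `i + 1` (addition is modulo `n`).
It is recorded as the unordered pair of these edges. -/
abbrev Propagator (n : ℕ) : Type := Sym2 (Fin n)

/-- The dependency set `V_p = {i, i + 1, j, j + 1}` of the propagator `p = (i, j)`. -/
def depSet {n : ℕ} [NeZero n] (p : Propagator n) : Finset (Fin n) :=
  Finset.univ.filter fun v => ∃ i ∈ p, v = i ∨ v = i + 1

/-- The dependency set `V_P`, the union of the `V_p` over `p ∈ P`. -/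
def depSetOf {n : ℕ} [NeZero n] (P : Finset (Propagator n)) : Finset (Fin n) :=
  P.biUnion depSet

/-- A (well defined) Wilson loop diagram `W = (𝒫, [n])`: a set of propagators such that no
non-empty `P ⊆ 𝒫` satisfies `|P| + 2 ≥ |V_P|`. -/
structure WilsonLoop (n : ℕ) [NeZero n] where
  /-- The set `𝒫` of propagators. -/
  props : Finset (Propagator n)
  wellDefined : ∀ P ⊆ props, P.Nonempty → P.card + 2 < (depSetOf P).card

/-- The matroid `M` is connected: its ground set has no partition into two non-empty parts that
are mutually independent, i.e. such that the union of an independent subset of one part and an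
independent subset of the other is always independent. -/
def IsConnected {α : Type*} (M : Matroid α) : Prop :=
  ¬ ∃ E₁ E₂ : Set α, E₁.Nonempty ∧ E₂.Nonempty ∧ Disjoint E₁ E₂ ∧ E₁ ∪ E₂ = M.E ∧
    ∀ I₁ I₂ : Set α, I₁ ⊆ E₁ → I₂ ⊆ E₂ → M.Indep I₁ → M.Indep I₂ → M.Indep (I₁ ∪ I₂)

/-- A cyclic flat: a flat that is a union of circuits. -/
def IsCyclicFlat {α : Type*} (M : Matroid α) (F : Set α) : Prop :=
  M.IsFlat F ∧ ∃ 𝒞 : Set (Set α), (∀ C ∈ 𝒞, M.IsCircuit C) ∧ F = ⋃₀ 𝒞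

/-- A flacet of `M`: a set `F ⊆ E` such that `M|F` and `M/F` are both connected. -/
def IsFlacet {α : Type*} (M : Matroid α) (F : Set α) : Prop :=
  F ⊆ M.E ∧ IsConnected (M.restrict F) ∧ IsConnected (M.contract F)

namespace WilsonLoop

variable {n : ℕ} [NeZero n]

/-- `Prop(U)`: the propagators of `W` that depend on some vertex in `U`. -/
def propOf (W : WilsonLoop n) (U : Finset (Fin n)) : Finset (Propagator n) :=
  W.props.filter fun p => ∃ v ∈ U, v ∈ depSet p

/-- No subset `U ⊆ B` has `|U| > |Prop(U)|`. -/
def Hall (W : WilsonLoop n) (B : Finset (Fin n)) : Prop :=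
  ∀ U ⊆ B, ¬ (W.propOf U).card < U.card

theorem propOf_mono (W : WilsonLoop n) {U V : Finset (Fin n)} (h : U ⊆ V) :
    W.propOf U ⊆ W.propOf V := by
  intro p hp
  simp only [propOf, Finset.mem_filter] at hp ⊢
  obtain ⟨hp, v, hv, hvp⟩ := hp
  exact ⟨hp, v, h hv, hvp⟩

theorem propOf_union (W : WilsonLoop n) (U V : Finset (Fin n)) :
    W.propOf (U ∪ V) = W.propOf U ∪ W.propOf V := by
  ext p
  simp only [propOf, Finset.mem_filter, Finset.mem_union]
  grind

theorem propOf_inter_subset (W : WilsonLoop n) (U V : Finset (Fin n)) :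
    W.propOf (U ∩ V) ⊆ W.propOf U ∩ W.propOf V :=
  Finset.subset_inter (W.propOf_mono Finset.inter_subset_left)
    (W.propOf_mono Finset.inter_subset_right)

theorem Hall.mono {W : WilsonLoop n} {I J : Finset (Fin n)} (hJ : W.Hall J) (h : I ⊆ J) :
    W.Hall I := fun U hU => hJ U (hU.trans h)

/-- Augmentation for sets satisfying the condition `Hall`. -/
theorem Hall.augment {W : WilsonLoop n} {I J : Finset (Fin n)} (hI : W.Hall I) (hJ : W.Hall J)
    (hlt : I.card < J.card) : ∃ e ∈ J, e ∉ I ∧ W.Hall (insert e I) := by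
  by_contra hno
  push Not at hno
  have hclaim : ∀ S : Finset (Fin n), S ⊆ J \ I → ∃ T ⊆ I, (W.propOf T).card = T.card ∧
      W.propOf S ⊆ W.propOf T := by
    intro S
    induction S using Finset.induction_on with
    | empty =>
      intro _
      exact ⟨∅, by simp, by simp [propOf], by simp [propOf]⟩
    | insert e S heS ih =>
      intro hS
      obtain ⟨T, hTI, hT, hST⟩ := ih ((Finset.subset_insert e S).trans hS)
      have he := Finset.mem_sdiff.1 (hS (Finset.mem_insert_self e S))
      have hne := hno e he.1 he.2
      unfold Hall at hne
      push Not at hne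
      obtain ⟨U, hU, hUc⟩ := hne
      have heU : e ∈ U := by
        by_contra heU
        exact hI U ((Finset.subset_insert_iff_of_notMem heU).1 hU) hUc
      have hT'I : U.erase e ⊆ I := Finset.subset_insert_iff.1 hU
      have h1 := hI _ hT'I
      have h2 := Finset.card_le_card (W.propOf_mono (Finset.erase_subset e U))
      have h3 := Finset.card_erase_add_one heU
      have h4 : W.propOf (U.erase e) = W.propOf U :=
        Finset.eq_of_subset_of_card_le (W.propOf_mono (Finset.erase_subset e U)) (by omega)
      have h5 : W.propOf {e} ⊆ W.propOf (U.erase e) := by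
        rw [h4]
        exact W.propOf_mono (by simpa using heU)
      refine ⟨T ∪ U.erase e, Finset.union_subset hTI hT'I, ?_, ?_⟩
      · have h6 := hI _ (Finset.union_subset hTI hT'I)
        have h7 := hI (T ∩ U.erase e) (Finset.inter_subset_left.trans hTI)
        have h8 := Finset.card_le_card (W.propOf_inter_subset T (U.erase e))
        have h9 := Finset.card_union_add_card_inter (W.propOf T) (W.propOf (U.erase e))
        have h10 := Finset.card_union_add_card_inter T (U.erase e)
        rw [W.propOf_union] at h6 ⊢
        omega
      · rw [W.propOf_union, Finset.insert_eq, W.propOf_union]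
        grind
  obtain ⟨T, hTI, hT, hST⟩ := hclaim (J \ I) subset_rfl
  have h1 := hJ ((J \ I) ∪ (J ∩ T)) (by grind)
  have h2 : W.propOf ((J \ I) ∪ (J ∩ T)) ⊆ W.propOf T := by
    rw [W.propOf_union]
    exact Finset.union_subset hST (W.propOf_mono Finset.inter_subset_right)
  have h3 := Finset.card_le_card h2
  have h4 : Disjoint (J \ I) (J ∩ T) := by
    rw [Finset.disjoint_left]
    grind
  rw [Finset.card_union_of_disjoint h4] at h1
  have h5 := Finset.card_sdiff_add_card_inter T J
  have h6 := Finset.card_le_card (Finset.sdiff_subset_sdiff hTI (subset_refl J))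
  have h7 := Finset.card_sdiff_add_card_inter J I
  have h8 := Finset.card_sdiff_add_card_inter I J
  rw [Finset.inter_comm T J] at h5
  rw [Finset.inter_comm I J] at h8
  omega

theorem exists_basis (W : WilsonLoop n) :
    ∃ B : Finset (Fin n), B.card = W.props.card ∧ W.Hall B := by
  obtain ⟨f, hf, hfm⟩ := (Finset.all_card_le_biUnion_card_iff_exists_injective
    (fun p : {p // p ∈ W.props} => depSet p.1)).1 (by
      intro s
      rcases s.eq_empty_or_nonempty with rfl | hs
      · simp
      have h := W.wellDefined (s.map (Function.Embedding.subtype _))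
        (by intro p hp; simp only [Finset.mem_map] at hp; obtain ⟨q, -, rfl⟩ := hp; exact q.2)
        (by simpa using hs)
      have h' : depSetOf (s.map (Function.Embedding.subtype _)) =
          s.biUnion fun p => depSet p.1 := by
        ext v
        simp [depSetOf]
      rw [h', Finset.card_map] at h
      omega)
  refine ⟨Finset.univ.image f, by simp [Finset.card_image_of_injective _ hf], ?_⟩
  intro U hU
  rw [not_lt]
  have h1 : U = (Finset.univ.filter fun p => f p ∈ U).image f := by
    ext v
    simp only [Finset.mem_image, Finset.mem_filter, Finset.mem_univ, true_and]
    constructor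
    · intro hv
      obtain ⟨p, -, rfl⟩ := Finset.mem_image.1 (hU hv)
      exact ⟨p, hv, rfl⟩
    · rintro ⟨p, hp, rfl⟩
      exact hp
  have h2 : (Finset.univ.filter fun p => f p ∈ U).map (Function.Embedding.subtype _) ⊆
      W.propOf U := by
    intro p hp
    simp only [Finset.mem_map, Finset.mem_filter, Finset.mem_univ, true_and] at hp
    obtain ⟨q, hq, rfl⟩ := hp
    exact Finset.mem_filter.2 ⟨q.2, f q, hq, hfm q⟩
  have h3 := Finset.card_le_card h2
  rw [Finset.card_map] at h3
  calc U.card = _ := congrArg Finset.card h1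
    _ ≤ _ := Finset.card_image_le
    _ ≤ _ := h3

/-- The matroid `M(W)` on `[n]`, with bases
`{B ⊆ [n] : |B| = |𝒫| and no U ⊆ B has |U| > |Prop(U)|}`. -/
def matroid (W : WilsonLoop n) : Matroid (Fin n) :=
  Matroid.ofIsBaseOfFinite (E := Set.univ) Set.finite_univ
    (fun B => ∃ B' : Finset (Fin n), (B' : Set (Fin n)) = B ∧
      B'.card = W.props.card ∧ W.Hall B')
    (by
      obtain ⟨B, hB⟩ := W.exists_basis
      exact ⟨B, B, rfl, hB⟩)
    (by
      rintro _ _ ⟨X, rfl, hXc, hX⟩ ⟨Y, rfl, hYc, hY⟩ a ha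
      have haX : a ∈ X := by simpa using ha.1
      have hlt : (X.erase a).card < Y.card := by
        have := Finset.card_erase_add_one haX
        omega
      obtain ⟨e, heY, heX, he⟩ := (hX.mono (Finset.erase_subset a X)).augment hY hlt
      have hea : e ≠ a := by
        rintro rfl
        exact ha.2 (by simpa using heY)
      refine ⟨e, ⟨by simpa using heY, ?_⟩, insert e (X.erase a), by simp, ?_, he⟩
      · intro heX'
        exact heX (Finset.mem_erase.2 ⟨hea, by simpa using heX'⟩)
      · rw [Finset.card_insert_of_notMem heX, Finset.card_erase_add_one haX, hXc])
    (fun _ _ => Set.subset_univ _)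

/-- `W` is a connected Wilson loop: its matroid `M(W)` is connected. -/
def Connected (W : WilsonLoop n) : Prop := IsConnected W.matroid

/-- `F(P)`: the vertices of `[n]` that only define propagators in `P`. -/
def flat (W : WilsonLoop n) (P : Finset (Propagator n)) : Finset (Fin n) :=
  Finset.univ.filter fun v => ∀ p ∈ W.props, v ∈ depSet p → p ∈ P

/-- `F(P)` has maximal rank: `rk F(P) = |P| < |F(P)|`. -/
def HasMaximalRank (W : WilsonLoop n) (P : Finset (Propagator n)) : Prop :=
  W.matroid.eRk (W.flat P) = (P.card : ℕ∞) ∧ P.card < (W.flat P).card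

end WilsonLoop

end WilsonLoops

/-!
`M(W)` is the transversal matroid of the incidence graph between vertices and propagators, and the
proof rests on Ore's rank formula `rk X = min {|X \ T| + |Prop(T)| : T ⊆ X}`
(`exists_card_eq_of_isBasis`).

A flacet `F` with at least two elements inside and not exactly one outside is a cyclic flat: a
connected matroid on two or more elements has no coloops and no loops, which applies to `M|F` and
to `M/F` (`IsFlacet.isCyclicFlat`). For a cyclic flat the minimum in the rank formula is attained
at `T = F` only, since the elements of `F \ T` would be coloops of `M|F`. Hence
`rk F = |Prop(F)|`, and `F = F(P)` with `P = Prop(F)` (`eq_flat_propOf`).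

It remains to compare connectedness of the two minors with the two conditions on partitions, for a
cyclic flat `F(P)` of rank `|P|`. Both minors are transversal: `M|F(P)` with propagators `P`, and
`M/F(P)` with propagators `𝒫 \ P` on the vertices `V_{𝒫 \ P}`, because a basis of `F(P)` uses up all
of `P` (`contract_flat_eq`). In both, every non-empty set `Q` of propagators depends on more than
`|Q|` vertices: in the first by cyclicity, in the second since `W` is well defined. Under this
condition the rank formula shows that the matroid is connected if and only if the incidence graph is
(`isConnected_restrict_iff`), and the latter is what the conditions on partitions express. That `W`
is connected is used only to know that every vertex supports a propagator.
-/

namespace WilsonLoops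

open Set

/-! ### Connected matroids -/

section Matroid

variable {α : Type*} {M : Matroid α}

/-- A connected matroid on at least two elements has neither loops nor coloops: otherwise `{e}`
and its complement would be mutually independent. -/
theorem IsConnected.indep_singleton_and_exists_isCircuit (hM : IsConnected M)
    (hnt : M.E.Nontrivial) {e : α} (he : e ∈ M.E) :
    M.Indep {e} ∧ ∃ C, M.IsCircuit C ∧ e ∈ C := by
  obtain ⟨f, hf, hfe⟩ := hnt.exists_ne e
  have h : ¬ ∀ I₁ I₂ : Set α, I₁ ⊆ {e} → I₂ ⊆ M.E \ {e} → M.Indep I₁ → M.Indep I₂ →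
      M.Indep (I₁ ∪ I₂) := fun h => hM ⟨{e}, M.E \ {e}, singleton_nonempty e, ⟨f, hf, hfe⟩,
        disjoint_sdiff_right, by simpa using insert_eq_of_mem he, h⟩
  push Not at h
  obtain ⟨I₁, I₂, h1, h2, hI1, hI2, hI⟩ := h
  rcases subset_singleton_iff_eq.1 h1 with rfl | rfl
  · exact absurd (by simpa using hI2) hI
  · refine ⟨hI1, ?_⟩
    rw [singleton_union] at hI
    exact ⟨_, hI2.fundCircuit_isCircuit
      ((hI2.mem_closure_iff_of_notMem fun h => (h2 h).2 rfl).2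
        ((Matroid.not_indep_iff (insert_subset he hI2.subset_ground)).1 hI)) fun h => (h2 h).2 rfl,
      M.mem_fundCircuit e I₂⟩

/-- Elements of `F` lie on circuits by connectedness of `M|F`; elements outside `F` are not loops
of `M/F`, hence not in the closure of `F`, by connectedness of `M/F`. -/
theorem IsFlacet.isCyclicFlat {F : Set α} (h : IsFlacet M F) (hF : F.Nontrivial)
    (hFc : (M.E \ F).Subsingleton → M.E \ F = ∅) : IsCyclicFlat M F := by
  obtain ⟨hFE, hr, hc⟩ := h
  refine ⟨?_, {C | M.IsCircuit C ∧ C ⊆ F}, fun C hC => hC.1, ?_⟩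
  · rw [Matroid.isFlat_iff_closure_eq]
    refine subset_antisymm (fun e he => ?_) (M.subset_closure F hFE)
    by_contra heF
    have heE : e ∈ M.E \ F := ⟨M.closure_subset_ground F he, heF⟩
    have hnt : (M.contract F).E.Nontrivial := by
      rw [Matroid.contract_ground, ← not_subsingleton_iff]
      intro hs
      rw [hFc hs] at heE
      exact heE
    have hi := (hc.indep_singleton_and_exists_isCircuit hnt (by simpa using heE)).1
    obtain ⟨I, hI⟩ := M.exists_isBasis F
    rw [hI.contract_indep_iff, singleton_union] at hi
    rw [← hI.closure_eq_closure] at he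
    exact ((hI.indep.mem_closure_iff_of_notMem fun h => heF (hI.subset h)).1 he).not_indep hi.1
  · refine subset_antisymm (fun e he => ?_) (sUnion_subset fun C hC => hC.2)
    obtain ⟨C, hC, heC⟩ := (hr.indep_singleton_and_exists_isCircuit (by simpa using hF)
      (by simpa using he)).2
    exact ⟨C, (Matroid.restrict_isCircuit_iff hFE).1 hC, heC⟩

/-- An element of a cyclic set is avoided by some basis of that set. -/
theorem IsCyclicFlat.exists_isBasis_notMem {F : Set α} (hF : IsCyclicFlat M F) {e : α}
    (he : e ∈ F) : ∃ I, M.IsBasis I F ∧ e ∉ I := by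
  obtain ⟨hfl, 𝒞, h𝒞, hu⟩ := hF
  rw [hu] at he
  obtain ⟨C, hC, heC⟩ := he
  have hCF : C ⊆ F := hu ▸ subset_sUnion_of_mem hC
  obtain ⟨I, hI, hsub⟩ := ((h𝒞 C hC).sdiff_singleton_indep heC).subset_isBasis_of_subset
    (sdiff_subset.trans hCF) hfl.subset_ground
  refine ⟨I, hI, fun heI => (h𝒞 C hC).dep.not_indep (hI.indep.subset fun x hx => ?_)⟩
  by_cases hxe : x = e
  · exact hxe ▸ heI
  · exact hsub ⟨hx, hxe⟩

end Matroid

namespace WilsonLoop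

variable {n : ℕ} [NeZero n] {W : WilsonLoop n}

/-! ### The rank formula -/

theorem mem_propOf {U : Finset (Fin n)} {p : Propagator n} :
    p ∈ W.propOf U ↔ p ∈ W.props ∧ ∃ v ∈ U, v ∈ depSet p := Finset.mem_filter

theorem propOf_empty (W : WilsonLoop n) : W.propOf ∅ = ∅ := by simp [propOf]

theorem propOf_subset (W : WilsonLoop n) (U : Finset (Fin n)) : W.propOf U ⊆ W.props :=
  Finset.filter_subset _ _

theorem Hall.card_le {I U : Finset (Fin n)} (hI : W.Hall I) (hU : U ⊆ I) :
    U.card ≤ (W.propOf U).card := not_lt.1 (hI U hU)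

theorem matroid_indep_iff {I : Finset (Fin n)} : W.matroid.Indep (I : Set (Fin n)) ↔ W.Hall I := by
  rw [Matroid.indep_iff]
  constructor
  · rintro ⟨_, ⟨B, rfl, -, hB⟩, hIB⟩
    exact hB.mono (by simpa using hIB)
  · intro hI
    obtain ⟨J, hIJ, hJ⟩ := (Set.toFinite {J | W.Hall J}).exists_le_maximal hI
    refine ⟨J, ⟨J, rfl, le_antisymm ?_ ?_, hJ.prop⟩, by simpa using hIJ⟩
    · exact (hJ.prop.card_le subset_rfl).trans (Finset.card_le_card (W.propOf_subset J))
    · by_contra! hlt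
      obtain ⟨B, hBc, hB⟩ := W.exists_basis
      obtain ⟨e, -, heJ, he⟩ := hJ.prop.augment hB (hBc ▸ hlt)
      exact heJ (hJ.le_of_ge he (Finset.subset_insert e J) (Finset.mem_insert_self e J))

theorem matroid_ground : W.matroid.E = univ := rfl

theorem exists_isBasis (W : WilsonLoop n) (X : Finset (Fin n)) :
    ∃ I : Finset (Fin n), W.matroid.IsBasis (I : Set (Fin n)) (X : Set (Fin n)) := by
  obtain ⟨I, hI⟩ := W.matroid.exists_isBasis (X : Set (Fin n)) (subset_univ _)
  lift I to Finset (Fin n) using Set.toFinite I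
  exact ⟨I, hI⟩

theorem isBasis_card_le_propOf {I X : Finset (Fin n)}
    (h : W.matroid.IsBasis (I : Set (Fin n)) (X : Set (Fin n))) :
    I.card ≤ (W.propOf X).card :=
  ((matroid_indep_iff.1 h.indep).card_le subset_rfl).trans
    (Finset.card_le_card (W.propOf_mono (by simpa using h.subset)))

/-- Elements that cannot be added to the independent set `I` are blocked by tight subsets of `I`,
whose union is again a tight subset of `I`. -/
theorem Hall.exists_tight {I : Finset (Fin n)} (hI : W.Hall I) (S : Finset (Fin n))
    (hS : ∀ e ∈ S, e ∉ I ∧ ¬ W.Hall (insert e I)) :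
    ∃ T ⊆ I, (W.propOf T).card = T.card ∧ W.propOf S ⊆ W.propOf T := by
  induction S using Finset.induction_on with
  | empty => exact ⟨∅, by simp, by simp [propOf_empty], by simp [propOf_empty]⟩
  | insert e S heS ih =>
    obtain ⟨T, hTI, hT, hST⟩ := ih fun x hx => hS x (Finset.mem_insert_of_mem hx)
    obtain ⟨he, hne⟩ := hS e (Finset.mem_insert_self e S)
    unfold Hall at hne
    push Not at hne
    obtain ⟨U, hU, hUc⟩ := hne
    have heU : e ∈ U := by
      by_contra heU
      exact hI U ((Finset.subset_insert_iff_of_notMem heU).1 hU) hUc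
    have hUI : U.erase e ⊆ I := Finset.subset_insert_iff.1 hU
    have h1 := hI.card_le hUI
    have h2 := Finset.card_le_card (W.propOf_mono (Finset.erase_subset e U))
    have h3 := Finset.card_erase_add_one heU
    have h4 : W.propOf (U.erase e) = W.propOf U :=
      Finset.eq_of_subset_of_card_le (W.propOf_mono (Finset.erase_subset e U)) (by omega)
    refine ⟨T ∪ U.erase e, Finset.union_subset hTI hUI, ?_, ?_⟩
    · have h6 := hI.card_le (Finset.union_subset hTI hUI)
      have h7 := hI.card_le (U := T ∩ U.erase e) (Finset.inter_subset_left.trans hTI)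
      have h8 := Finset.card_le_card (W.propOf_inter_subset T (U.erase e))
      have h9 := Finset.card_union_add_card_inter (W.propOf T) (W.propOf (U.erase e))
      have h10 := Finset.card_union_add_card_inter T (U.erase e)
      rw [W.propOf_union] at h6 ⊢
      omega
    · rw [W.propOf_union, h4, Finset.insert_eq, W.propOf_union]
      exact Finset.union_subset
        ((W.propOf_mono (by simpa using heU)).trans Finset.subset_union_right)
        (hST.trans Finset.subset_union_left)

/-- Ore's rank formula for transversal matroids: some `T ⊆ X` attains the bound
`rk X ≤ |X \ T| + |Prop(T)|`. -/
theorem exists_card_eq_of_isBasis {I X : Finset (Fin n)}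
    (h : W.matroid.IsBasis (I : Set (Fin n)) (X : Set (Fin n))) :
    ∃ T ⊆ X, I.card = (X \ T).card + (W.propOf T).card := by
  have hIX : I ⊆ X := by simpa using h.subset
  obtain ⟨T, hTI, hT, hS⟩ := (matroid_indep_iff.1 h.indep).exists_tight (X \ I) fun e he => by
    obtain ⟨heX, heI⟩ := Finset.mem_sdiff.1 he
    refine ⟨heI, fun hh => heI ?_⟩
    rw [← matroid_indep_iff, Finset.coe_insert] at hh
    simpa using h.mem_of_insert_indep (by simpa using heX) hh
  refine ⟨(X \ I) ∪ T, Finset.union_subset Finset.sdiff_subset (hTI.trans hIX), ?_⟩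
  rw [W.propOf_union, Finset.union_eq_right.2 hS, hT,
    show X \ ((X \ I) ∪ T) = I \ T by grind, Finset.card_sdiff_add_card_eq_card hTI]

/-! ### Connectedness and the incidence graph -/

/-- If every non-empty set `Q` of propagators meeting `X` depends on more than `|Q|` elements of
`X`, then `M(W)|X` is connected exactly when the incidence graph between `X` and `Prop(X)` is. -/
theorem isConnected_restrict_iff {X : Finset (Fin n)}
    (hX : ∀ Q ⊆ W.propOf X, Q.Nonempty → Q.card < (depSetOf Q ∩ X).card) :
    IsConnected (W.matroid.restrict (X : Set (Fin n))) ↔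
      ¬ ∃ X₁ X₂ : Finset (Fin n), X₁.Nonempty ∧ X₂.Nonempty ∧ Disjoint X₁ X₂ ∧ X₁ ∪ X₂ = X ∧
        Disjoint (W.propOf X₁) (W.propOf X₂) := by
  refine not_congr ⟨?_, ?_⟩
  · rintro ⟨E₁, E₂, hE1, hE2, hd, hu, h⟩
    rw [Matroid.restrict_ground_eq] at hu
    lift E₁ to Finset (Fin n) using Set.toFinite E₁
    lift E₂ to Finset (Fin n) using Set.toFinite E₂
    have hu : E₁ ∪ E₂ = X := by exact_mod_cast hu
    rw [Finset.disjoint_coe] at hd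
    obtain ⟨I₁, hI1⟩ := W.exists_isBasis E₁
    obtain ⟨I₂, hI2⟩ := W.exists_isBasis E₂
    obtain ⟨T₁, hT1, hc1⟩ := exists_card_eq_of_isBasis hI1
    obtain ⟨T₂, hT2, hc2⟩ := exists_card_eq_of_isBasis hI2
    have hs1 : I₁ ⊆ E₁ := by simpa using hI1.subset
    have hs2 : I₂ ⊆ E₂ := by simpa using hI2.subset
    have hI := (h I₁ I₂ hI1.subset hI2.subset
      (Matroid.restrict_indep_iff.2
        ⟨hI1.indep, Finset.coe_subset.2 (hs1.trans (hu ▸ Finset.subset_union_left))⟩)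
      (Matroid.restrict_indep_iff.2
        ⟨hI2.indep, Finset.coe_subset.2 (hs2.trans (hu ▸ Finset.subset_union_right))⟩))
    rw [Matroid.restrict_indep_iff, ← Finset.coe_union, matroid_indep_iff] at hI
    have h1 := hI.1.card_le subset_rfl
    rw [Finset.card_union_of_disjoint (Finset.disjoint_of_subset_left hs1
      (Finset.disjoint_of_subset_right hs2 hd))] at h1
    have h2 : (W.propOf (I₁ ∪ I₂)).card ≤ (W.propOf X).card :=
      Finset.card_le_card (W.propOf_mono (hu ▸ Finset.union_subset_union hs1 hs2))
    -- The propagators avoiding `T₁ ∪ T₂` depend on too few elements of `X`, so there are none.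
    set Q := W.propOf X \ W.propOf (T₁ ∪ T₂) with hQ
    have hTX : T₁ ∪ T₂ ⊆ X := hu ▸ Finset.union_subset_union hT1 hT2
    have h3 : Q.card + (W.propOf (T₁ ∪ T₂)).card = (W.propOf X).card :=
      Finset.card_sdiff_add_card_eq_card (W.propOf_mono hTX)
    have h4 : depSetOf Q ∩ X ⊆ (E₁ \ T₁) ∪ (E₂ \ T₂) := by
      intro v hv
      obtain ⟨hvQ, hvX⟩ := Finset.mem_inter.1 hv
      obtain ⟨q, hq, hvq⟩ := Finset.mem_biUnion.1 hvQ
      obtain ⟨hq1, hq2⟩ := Finset.mem_sdiff.1 hq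
      have hvT : v ∉ T₁ ∪ T₂ := fun hvT => hq2 (mem_propOf.2 ⟨W.propOf_subset X hq1, v, hvT, hvq⟩)
      rw [← hu] at hvX
      grind
    have h5 := (Finset.card_le_card h4).trans (Finset.card_union_le _ _)
    have h6 := Finset.card_union_add_card_inter (W.propOf T₁) (W.propOf T₂)
    rw [← W.propOf_union] at h6
    have h7 : Q = ∅ := by
      by_contra hne
      have := hX Q Finset.sdiff_subset (Finset.nonempty_iff_ne_empty.2 hne)
      omega
    rw [h7, Finset.card_empty] at h3
    have h8 : E₁ \ T₁ = ∅ := Finset.card_eq_zero.1 (by omega)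
    have h9 : E₂ \ T₂ = ∅ := Finset.card_eq_zero.1 (by omega)
    have h10 : W.propOf T₁ ∩ W.propOf T₂ = ∅ := Finset.card_eq_zero.1 (by omega)
    obtain rfl := subset_antisymm hT1 (Finset.sdiff_eq_empty_iff_subset.1 h8)
    obtain rfl := subset_antisymm hT2 (Finset.sdiff_eq_empty_iff_subset.1 h9)
    exact ⟨T₁, T₂, by simpa using hE1, by simpa using hE2, hd, hu,
      Finset.disjoint_iff_inter_eq_empty.2 h10⟩
  · rintro ⟨X₁, X₂, h1, h2, hd, rfl, hN⟩
    refine ⟨X₁, X₂, by simpa using h1, by simpa using h2, by simpa using hd, by simp, ?_⟩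
    intro I₁ I₂ hs1 hs2 hI1 hI2
    lift I₁ to Finset (Fin n) using Set.toFinite I₁
    lift I₂ to Finset (Fin n) using Set.toFinite I₂
    rw [Matroid.restrict_indep_iff] at hI1 hI2 ⊢
    rw [matroid_indep_iff] at hI1 hI2
    refine ⟨?_, union_subset (hs1.trans (by simp)) (hs2.trans (by simp))⟩
    rw [← Finset.coe_union, matroid_indep_iff]
    intro U hU
    rw [not_lt]
    have hs1 : I₁ ⊆ X₁ := by simpa using hs1
    have hs2 : I₂ ⊆ X₂ := by simpa using hs2
    have h3 := hI1.1.card_le (U := U ∩ I₁) Finset.inter_subset_right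
    have h4 := hI2.1.card_le (U := U ∩ I₂) Finset.inter_subset_right
    have h5 : U = (U ∩ I₁) ∪ (U ∩ I₂) := by grind
    have h6 : Disjoint (W.propOf (U ∩ I₁)) (W.propOf (U ∩ I₂)) :=
      Finset.disjoint_of_subset_left (W.propOf_mono (Finset.inter_subset_right.trans hs1))
        (Finset.disjoint_of_subset_right (W.propOf_mono (Finset.inter_subset_right.trans hs2)) hN)
    rw [h5, W.propOf_union, Finset.card_union_of_disjoint h6]
    exact (Finset.card_union_le _ _).trans (add_le_add h3 h4)

/-- `W` connected and with a propagator: every vertex supports a propagator. -/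
theorem Connected.exists_mem_depSet (hW : W.Connected) (hne : W.props.Nonempty) (v : Fin n) :
    ∃ p ∈ W.props, v ∈ depSet p := by
  have h1 := W.wellDefined W.props subset_rfl hne
  have h2 := (depSetOf W.props).card_le_univ
  have hnt : W.matroid.E.Nontrivial := by
    have : 1 < Fintype.card (Fin n) := by omega
    rw [Fintype.one_lt_card_iff_nontrivial] at this
    exact nontrivial_univ
  have h3 := (IsConnected.indep_singleton_and_exists_isCircuit hW hnt (mem_univ v)).1
  rw [← Finset.coe_singleton, matroid_indep_iff] at h3
  have h4 := h3.card_le subset_rfl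
  obtain ⟨p, hp⟩ := Finset.card_pos.1 (show 0 < (W.propOf {v}).card by simpa using h4)
  exact ⟨p, by simpa using mem_propOf.1 hp⟩

/-! ### The sets `F(P)` -/

theorem mem_flat {P : Finset (Propagator n)} {v : Fin n} :
    v ∈ W.flat P ↔ ∀ p ∈ W.props, v ∈ depSet p → p ∈ P := by simp [flat]

theorem flat_mono (W : WilsonLoop n) {P Q : Finset (Propagator n)} (h : P ⊆ Q) :
    W.flat P ⊆ W.flat Q :=
  fun _ hv => mem_flat.2 fun p hp hvp => h (mem_flat.1 hv p hp hvp)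

theorem propOf_subset_iff {X : Finset (Fin n)} {P : Finset (Propagator n)} :
    W.propOf X ⊆ P ↔ X ⊆ W.flat P := by
  constructor
  · exact fun h v hv => mem_flat.2 fun p hp hvp => h (mem_propOf.2 ⟨hp, v, hv, hvp⟩)
  · intro h p hp
    obtain ⟨hp, v, hv, hvp⟩ := mem_propOf.1 hp
    exact mem_flat.1 (h hv) p hp hvp

theorem compl_flat (W : WilsonLoop n) (P : Finset (Propagator n)) :
    (W.flat P)ᶜ = depSetOf (W.props \ P) := by
  ext v
  simp [depSetOf, mem_flat]
  grind

/-- Removing any one element from a cyclic flat keeps its rank, so the rank formula is attained by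
the whole set only. -/
theorem eq_of_card_le {F I T : Finset (Fin n)}
    (hF : IsCyclicFlat W.matroid (F : Set (Fin n)))
    (hI : W.matroid.IsBasis (I : Set (Fin n)) (F : Set (Fin n))) (hT : T ⊆ F)
    (hc : (F \ T).card + (W.propOf T).card ≤ I.card) : T = F := by
  refine subset_antisymm hT fun e he => ?_
  by_contra heT
  obtain ⟨J, hJ, heJ⟩ := hF.exists_isBasis_notMem (e := e) (by simpa using he)
  lift J to Finset (Fin n) using Set.toFinite J
  have hJF : J ⊆ F := by simpa using hJ.subset
  have h1 : J.card = I.card := by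
    have := hJ.encard_eq_eRk.trans hI.encard_eq_eRk.symm
    simpa using this
  have h2 := (matroid_indep_iff.1 hJ.indep).card_le (U := J ∩ T) Finset.inter_subset_left
  have h3 := Finset.card_le_card (W.propOf_mono (Finset.inter_subset_right : J ∩ T ⊆ T))
  have h4 := Finset.card_sdiff_add_card_inter J T
  have h5 : (J \ T).card < (F \ T).card := Finset.card_lt_card <|
    (Finset.ssubset_iff_of_subset (Finset.sdiff_subset_sdiff hJF subset_rfl)).2
      ⟨e, Finset.mem_sdiff.2 ⟨he, heT⟩, fun h => heJ (by simpa using (Finset.mem_sdiff.1 h).1)⟩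
  omega

theorem isBasis_card_eq_propOf {F I : Finset (Fin n)}
    (hF : IsCyclicFlat W.matroid (F : Set (Fin n)))
    (hI : W.matroid.IsBasis (I : Set (Fin n)) (F : Set (Fin n))) :
    I.card = (W.propOf F).card := by
  obtain ⟨T, hT, hc⟩ := exists_card_eq_of_isBasis hI
  obtain rfl := eq_of_card_le hF hI hT hc.ge
  simpa using hc

/-- A cyclic flat `F` has rank `|Prop(F)|` and is therefore all of `F(Prop(F))`. -/
theorem eq_flat_propOf {F : Finset (Fin n)} (hF : IsCyclicFlat W.matroid (F : Set (Fin n))) :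
    F = W.flat (W.propOf F) := by
  have hsub : F ⊆ W.flat (W.propOf F) := propOf_subset_iff.1 subset_rfl
  refine subset_antisymm hsub ?_
  obtain ⟨I, hI⟩ := W.exists_isBasis F
  obtain ⟨J, hJ, hIJ⟩ := hI.indep.subset_isBasis_of_subset
    (hI.subset.trans (Finset.coe_subset.2 hsub)) (subset_univ _)
  lift J to Finset (Fin n) using Set.toFinite J
  have h1 := isBasis_card_eq_propOf hF hI
  have h2 := (isBasis_card_le_propOf hJ).trans
    (Finset.card_le_card (propOf_subset_iff.2 subset_rfl))
  obtain rfl := Finset.eq_of_subset_of_card_le (Finset.coe_subset.1 hIJ) (by omega)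
  exact Finset.coe_subset.1 (hF.1.subset_of_isBasis_of_isBasis hI hJ)

theorem hasMaximalRank_propOf {F : Finset (Fin n)}
    (hF : IsCyclicFlat W.matroid (F : Set (Fin n))) (hne : F.Nonempty) :
    W.HasMaximalRank (W.propOf F) := by
  unfold HasMaximalRank
  rw [← eq_flat_propOf hF]
  obtain ⟨e, he⟩ := hne
  obtain ⟨I, hI, heI⟩ := hF.exists_isBasis_notMem (e := e) (by simpa using he)
  lift I to Finset (Fin n) using Set.toFinite I
  have h1 := isBasis_card_eq_propOf hF hI
  refine ⟨by rw [← hI.encard_eq_eRk, ← h1]; simp, ?_⟩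
  rw [← h1]
  exact Finset.card_lt_card ((Finset.ssubset_iff_of_subset (by simpa using hI.subset)).2
    ⟨e, he, by simpa using heI⟩)

theorem HasMaximalRank.isBasis_card_eq {P : Finset (Propagator n)} {I : Finset (Fin n)}
    (h : W.HasMaximalRank P)
    (hI : W.matroid.IsBasis (I : Set (Fin n)) (W.flat P : Set (Fin n))) : I.card = P.card := by
  have := hI.encard_eq_eRk.trans h.1
  simpa using this

theorem HasMaximalRank.propOf_flat {P : Finset (Propagator n)} (h : W.HasMaximalRank P) :
    W.propOf (W.flat P) = P := by
  obtain ⟨I, hI⟩ := W.exists_isBasis (W.flat P)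
  exact Finset.eq_of_subset_of_card_le (propOf_subset_iff.2 subset_rfl)
    (h.isBasis_card_eq hI ▸ isBasis_card_le_propOf hI)

/-! ### The restriction to `F(P)` -/

theorem isConnected_restrict_flat_iff (hloop : ∀ v, ∃ p ∈ W.props, v ∈ depSet p)
    {P : Finset (Propagator n)} (hF : IsCyclicFlat W.matroid (W.flat P : Set (Fin n)))
    (hr : W.HasMaximalRank P) :
    IsConnected (W.matroid.restrict (W.flat P : Set (Fin n))) ↔
      ∀ P₁ P₂ : Finset (Propagator n), P₁.Nonempty → P₂.Nonempty → Disjoint P₁ P₂ → P₁ ∪ P₂ = P →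
        ¬ (Disjoint (W.flat P₁) (W.flat P₂) ∧ W.flat P₁ ∪ W.flat P₂ = W.flat P) := by
  have hprop := hr.propOf_flat
  rw [isConnected_restrict_iff]
  · constructor
    · rintro h P₁ P₂ h1 h2 hd hu ⟨hfd, hfu⟩
      have hs1 : W.propOf (W.flat P₁) ⊆ P₁ := propOf_subset_iff.2 subset_rfl
      have hs2 : W.propOf (W.flat P₂) ⊆ P₂ := propOf_subset_iff.2 subset_rfl
      have hPu : W.propOf (W.flat P₁) ∪ W.propOf (W.flat P₂) = P := by
        rw [← W.propOf_union, hfu, hprop]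
      have hd' := Finset.disjoint_left.1 hd
      refine h ⟨_, _, ?_, ?_, hfd, hfu,
        Finset.disjoint_of_subset_left hs1 (Finset.disjoint_of_subset_right hs2 hd)⟩
      · rw [Finset.nonempty_iff_ne_empty]
        intro h0
        obtain ⟨p, hp⟩ := h1
        rw [h0] at hPu
        rw [propOf_empty, Finset.empty_union] at hPu
        exact hd' hp (hs2 (hPu ▸ hu ▸ Finset.mem_union_left _ hp))
      · rw [Finset.nonempty_iff_ne_empty]
        intro h0
        obtain ⟨p, hp⟩ := h2
        rw [h0] at hPu
        rw [propOf_empty, Finset.union_empty] at hPu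
        exact hd' (hs1 (hPu ▸ hu ▸ Finset.mem_union_right _ hp)) hp
    · rintro h ⟨X₁, X₂, ⟨x₁, h1⟩, ⟨x₂, h2⟩, hd, hu, hN⟩
      have hne : ∀ {X : Finset (Fin n)} {x}, x ∈ X → (W.propOf X).Nonempty := fun {X x} hx => by
        obtain ⟨p, hp, hxp⟩ := hloop x
        exact ⟨p, mem_propOf.2 ⟨hp, x, hx, hxp⟩⟩
      have hPu : W.propOf X₁ ∪ W.propOf X₂ = P := by rw [← W.propOf_union, hu, hprop]
      refine h _ _ (hne h1) (hne h2) hN hPu ⟨?_, ?_⟩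
      · rw [Finset.disjoint_left]
        intro v hv1 hv2
        obtain ⟨p, hp, hvp⟩ := hloop v
        exact Finset.disjoint_left.1 hN (mem_flat.1 hv1 p hp hvp) (mem_flat.1 hv2 p hp hvp)
      · refine subset_antisymm (Finset.union_subset (W.flat_mono (hPu ▸ Finset.subset_union_left))
          (W.flat_mono (hPu ▸ Finset.subset_union_right))) ?_
        rw [← hu]
        exact Finset.union_subset_union (propOf_subset_iff.1 subset_rfl)
          (propOf_subset_iff.1 subset_rfl)
  · rw [hprop]
    intro Q hQ hQne
    by_contra! hle
    obtain ⟨I, hI⟩ := W.exists_isBasis (W.flat P)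
    have hIc := hr.isBasis_card_eq hI
    -- The elements of `F(P)` outside `V_Q` would attain the rank formula, hence be all of `F(P)`;
    -- but then `Prop(F(P))` would miss `Q`.
    have hsub : W.propOf (W.flat P \ depSetOf Q) ⊆ P \ Q := by
      intro p hp
      obtain ⟨hpW, v, hv, hvp⟩ := mem_propOf.1 hp
      obtain ⟨hvF, hvQ⟩ := Finset.mem_sdiff.1 hv
      exact Finset.mem_sdiff.2 ⟨mem_flat.1 hvF p hpW hvp,
        fun hpQ => hvQ (Finset.mem_biUnion.2 ⟨p, hpQ, hvp⟩)⟩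
    have h1 := Finset.card_le_card hsub
    have h2 := Finset.card_sdiff_add_card_eq_card hQ
    have h3 : W.flat P \ (W.flat P \ depSetOf Q) = depSetOf Q ∩ W.flat P := by grind
    have h4 := eq_of_card_le hF hI (T := W.flat P \ depSetOf Q) Finset.sdiff_subset
      (by rw [h3]; omega)
    rw [h4, hprop] at h1
    have := hQne.card_pos
    omega

/-! ### The contraction by `F(P)` -/

/-- The Wilson loop diagram `(𝒫 \ P, [n])`. -/
def remove (W : WilsonLoop n) (P : Finset (Propagator n)) : WilsonLoop n where
  props := W.props \ P
  wellDefined Q hQ := W.wellDefined Q (hQ.trans Finset.sdiff_subset)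

/-- When `F(P)` has rank `|P|`, its bases match all of `P`, so contracting it leaves the
transversal matroid of the remaining propagators. -/
theorem contract_flat_eq {P : Finset (Propagator n)} (hr : W.HasMaximalRank P) :
    W.matroid.contract (W.flat P : Set (Fin n)) =
      (W.remove P).matroid.restrict ((W.flat P)ᶜ : Finset (Fin n)) := by
  obtain ⟨I, hI⟩ := W.exists_isBasis (W.flat P)
  have hIc := hr.isBasis_card_eq hI
  have hIF : I ⊆ W.flat P := by simpa using hI.subset
  have hIP : W.propOf I ⊆ P := propOf_subset_iff.2 hIF
  refine Matroid.ext_indep (by simp [matroid_ground, compl_eq_univ_sdiff]) fun J hJ => ?_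
  lift J to Finset (Fin n) using Set.toFinite J
  have hJF : Disjoint (W.flat P) J := by
    rw [← Finset.disjoint_coe]
    exact (disjoint_sdiff_right (t := univ)).mono_right hJ
  have hJc : J ⊆ (W.flat P)ᶜ := Finset.subset_compl_iff_disjoint_left.2 hJF
  rw [hI.contract_indep_iff, Matroid.restrict_indep_iff, ← Finset.coe_union, matroid_indep_iff,
    matroid_indep_iff, Finset.disjoint_coe, Finset.coe_subset, and_iff_left hJF, and_iff_left hJc]
  have hrem : ∀ U, (W.remove P).propOf U = W.propOf U \ P := by
    intro U
    ext p
    simp only [mem_propOf, remove, Finset.mem_sdiff]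
    tauto
  constructor
  · intro h U hU
    have h1 := h.card_le (Finset.union_subset_union_left (t := I) hU)
    rw [W.propOf_union, Finset.card_union_of_disjoint (Finset.disjoint_of_subset_left hU
      (Finset.disjoint_of_subset_right hIF hJF.symm))] at h1
    have h2 : W.propOf U ∪ W.propOf I ⊆ (W.propOf U \ P) ∪ P := by grind
    have h3 := (Finset.card_le_card h2).trans (Finset.card_union_le _ _)
    rw [hrem]
    omega
  · intro h U hU
    have h1 := h.card_le (U := U ∩ J) Finset.inter_subset_right
    have h2 := (matroid_indep_iff.1 hI.indep).card_le (U := U ∩ I) Finset.inter_subset_right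
    have h3 : (W.propOf (U ∩ J) \ P) ∪ W.propOf (U ∩ I) ⊆ W.propOf U :=
      Finset.union_subset (Finset.sdiff_subset.trans (W.propOf_mono Finset.inter_subset_left))
        (W.propOf_mono Finset.inter_subset_left)
    have h4 : Disjoint (W.propOf (U ∩ J) \ P) (W.propOf (U ∩ I)) :=
      Finset.disjoint_of_subset_right ((W.propOf_mono Finset.inter_subset_right).trans hIP)
        Finset.sdiff_disjoint
    have h5 := Finset.card_le_card h3
    have h6 : U = (U ∩ J) ∪ (U ∩ I) := by grind
    have h7 := Finset.card_union_le (U ∩ J) (U ∩ I)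
    rw [← h6] at h7
    rw [Finset.card_union_of_disjoint h4] at h5
    rw [hrem] at h1
    omega

theorem isConnected_contract_flat_iff {P : Finset (Propagator n)} (hr : W.HasMaximalRank P) :
    IsConnected (W.matroid.contract (W.flat P : Set (Fin n))) ↔
      ∀ Q₁ Q₂ : Finset (Propagator n), Q₁.Nonempty → Q₂.Nonempty → Disjoint Q₁ Q₂ →
        Q₁ ∪ Q₂ = W.props \ P →
        ¬ (Disjoint (depSetOf Q₁) (depSetOf Q₂) ∧
          depSetOf Q₁ ∪ depSetOf Q₂ = depSetOf (W.props \ P)) := by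
  rw [contract_flat_eq hr, compl_flat]
  have hdep : ∀ {Q q}, q ∈ Q → depSet q ⊆ depSetOf (n := n) Q :=
    fun hq => Finset.subset_biUnion_of_mem depSet hq
  have hpos : ∀ Q ⊆ W.props \ P, Q.Nonempty → Q.card + 2 < (depSetOf Q).card :=
    (W.remove P).wellDefined
  have hpos1 : ∀ q ∈ W.props \ P, (depSet q).Nonempty := fun q hq => by
    have := hpos {q} (by simpa using hq) (by simp)
    rw [depSetOf, Finset.singleton_biUnion] at this
    exact Finset.card_pos.1 (by omega)
  rw [isConnected_restrict_iff]
  · constructor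
    · rintro h Q₁ Q₂ h1 h2 hd hu ⟨hVd, hVu⟩
      have hs1 : Q₁ ⊆ W.props \ P := hu ▸ Finset.subset_union_left
      have hs2 : Q₂ ⊆ W.props \ P := hu ▸ Finset.subset_union_right
      have hV := Finset.disjoint_left.1 hVd
      refine h ⟨_, _, Finset.card_pos.1 (by have := hpos Q₁ hs1 h1; omega),
        Finset.card_pos.1 (by have := hpos Q₂ hs2 h2; omega), hVd, hVu, ?_⟩
      rw [Finset.disjoint_left]
      intro q hq1 hq2
      obtain ⟨hq, v, hv, hvq⟩ := mem_propOf.1 hq1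
      obtain ⟨-, w, hw, hwq⟩ := mem_propOf.1 hq2
      change q ∈ W.props \ P at hq
      rw [← hu] at hq
      rcases Finset.mem_union.1 hq with hq | hq
      · exact hV (hdep hq hwq) hw
      · exact hV hv (hdep hq hvq)
    · rintro h ⟨X₁, X₂, ⟨x₁, h1⟩, ⟨x₂, h2⟩, hd, hu, hN⟩
      have hne : ∀ {X : Finset (Fin n)} {x}, x ∈ X → x ∈ X₁ ∪ X₂ →
          ((W.remove P).propOf X).Nonempty := fun {X x} hx hx' => by
        rw [hu] at hx'
        obtain ⟨p, hp, hxp⟩ := Finset.mem_biUnion.1 hx'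
        exact ⟨p, mem_propOf.2 ⟨hp, x, hx, hxp⟩⟩
      have hQu : (W.remove P).propOf X₁ ∪ (W.remove P).propOf X₂ = W.props \ P := by
        rw [← propOf_union, hu]
        refine subset_antisymm (propOf_subset _ _) fun q hq => ?_
        obtain ⟨v, hv⟩ := hpos1 q hq
        exact mem_propOf.2 ⟨hq, v, hdep hq hv, hv⟩
      refine h _ _ (hne h1 (Finset.mem_union_left _ h1)) (hne h2 (Finset.mem_union_right _ h2))
        hN hQu ⟨?_, ?_⟩
      · rw [Finset.disjoint_left]
        intro v hv1 hv2
        obtain ⟨p, hp, hvp⟩ := Finset.mem_biUnion.1 hv1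
        obtain ⟨q, hq, hvq⟩ := Finset.mem_biUnion.1 hv2
        have hpP := propOf_subset _ _ hp
        have hqP := propOf_subset _ _ hq
        have hv := hdep hpP hvp
        change v ∈ depSetOf (W.props \ P) at hv
        rw [← hu] at hv
        rcases Finset.mem_union.1 hv with hv | hv
        · exact Finset.disjoint_left.1 hN (mem_propOf.2 ⟨hqP, v, hv, hvq⟩) hq
        · exact Finset.disjoint_left.1 hN hp (mem_propOf.2 ⟨hpP, v, hv, hvp⟩)
      · rw [← hQu, depSetOf, depSetOf, depSetOf, Finset.union_biUnion]
  · intro Q hQ hQne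
    have hQP : Q ⊆ W.props \ P := hQ.trans (propOf_subset _ _)
    have := hpos Q hQP hQne
    rw [Finset.inter_eq_left.2 (show depSetOf Q ⊆ depSetOf (W.props \ P) from
      Finset.biUnion_subset_biUnion_of_subset_left _ hQP)]
    omega

end WilsonLoop

end WilsonLoops

theorem mainTheorem10 {n : ℕ} [NeZero n] (W : WilsonLoops.WilsonLoop n)
    (hne : W.props.Nonempty) (hW : W.Connected) (F : Finset (Fin n)) :
    (WilsonLoops.IsFlacet W.matroid (F : Set (Fin n)) ∧ 2 ≤ F.card ∧ Fᶜ.card ≠ 1) ↔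
      ∃ P : Finset (WilsonLoops.Propagator n), P ⊆ W.props ∧ F = W.flat P ∧
        (WilsonLoops.IsCyclicFlat W.matroid (W.flat P : Set (Fin n)) ∧ W.HasMaximalRank P) ∧
        (∀ Q₁ Q₂ : Finset (WilsonLoops.Propagator n), Q₁.Nonempty → Q₂.Nonempty →
          Disjoint Q₁ Q₂ → Q₁ ∪ Q₂ = W.props \ P →
          ¬ (Disjoint (WilsonLoops.depSetOf Q₁) (WilsonLoops.depSetOf Q₂) ∧
              WilsonLoops.depSetOf Q₁ ∪ WilsonLoops.depSetOf Q₂ =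
                WilsonLoops.depSetOf (W.props \ P))) ∧
        (∀ P₁ P₂ : Finset (WilsonLoops.Propagator n), P₁.Nonempty → P₂.Nonempty →
          Disjoint P₁ P₂ → P₁ ∪ P₂ = P →
          ¬ (Disjoint (W.flat P₁) (W.flat P₂) ∧ W.flat P₁ ∪ W.flat P₂ = W.flat P)) := by
  have hloop := hW.exists_mem_depSet hne
  constructor
  · rintro ⟨hFl, h2, h1⟩
    have hcyc : WilsonLoops.IsCyclicFlat W.matroid (F : Set (Fin n)) := by
      refine hFl.isCyclicFlat ?_ fun hs => ?_
      · exact_mod_cast Finset.one_lt_card_iff_nontrivial.1 h2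
      · rw [WilsonLoops.WilsonLoop.matroid_ground, ← Set.compl_eq_univ_sdiff,
          ← Finset.coe_compl] at hs ⊢
        have := Finset.card_le_one_iff_subsingleton.2 hs
        rw [Finset.coe_eq_empty, ← Finset.card_eq_zero]
        omega
    have heq := WilsonLoops.WilsonLoop.eq_flat_propOf hcyc
    have hr := WilsonLoops.WilsonLoop.hasMaximalRank_propOf hcyc (Finset.card_pos.1 (by omega))
    rw [heq] at hFl
    have hcyc' := hcyc
    rw [heq] at hcyc'
    exact ⟨W.propOf F, W.propOf_subset F, heq, ⟨hcyc', hr⟩,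
      (WilsonLoops.WilsonLoop.isConnected_contract_flat_iff hr).1 hFl.2.2,
      (WilsonLoops.WilsonLoop.isConnected_restrict_flat_iff hloop hcyc' hr).1 hFl.2.1⟩
  · rintro ⟨P, -, rfl, ⟨hcyc, hr⟩, hQ, hP⟩
    refine ⟨⟨Set.subset_univ _,
      (WilsonLoops.WilsonLoop.isConnected_restrict_flat_iff hloop hcyc hr).2 hP,
      (WilsonLoops.WilsonLoop.isConnected_contract_flat_iff hr).2 hQ⟩, ?_, ?_⟩
    · have hPne : P.Nonempty := by
        -- As every vertex supports a propagator, `F(∅) = ∅`, which does not have maximal rank.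
        rw [Finset.nonempty_iff_ne_empty]
        rintro rfl
        obtain ⟨v, hv⟩ := Finset.card_pos.1 (Nat.zero_lt_of_lt hr.2)
        obtain ⟨p, hp, hvp⟩ := hloop v
        exact Finset.notMem_empty p (WilsonLoops.WilsonLoop.mem_flat.1 hv p hp hvp)
      have := hPne.card_pos
      have := hr.2
      omega
    · rw [W.compl_flat]
      rcases (W.props \ P).eq_empty_or_nonempty with h0 | hne'
      · rw [h0]
        simp [WilsonLoops.depSetOf]
      · have := W.wellDefined _ Finset.sdiff_subset hne'
        omega
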